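/- Consider eight parties $v_1,\dots,v_8$ with local dimensions $\boldsymbol d_0=(4,4,4,4,4,4,4,2)$, that is, with the total system $\overline{\mathcal H}=\bigotimes_{k=1}^8\overline{\mathcal H}^{v_k}$, $\dim\overline{\mathcal H}^{v_k}=4$ for $k\le 7$ and $\dim\overline{\mathcal H}^{v_8}=2$. Each $\overline{\mathcal H}^{v_k}$ contains a qubit $\mathcal H^{v_k}\cong\mathbb C^2$ as a subspace, and $\mathcal H=\bigotimes_k\mathcal H^{v_k}\subset\overline{\mathcal H}$. A state $|\phi\rangle\in\overline{\mathcal H}$ *consists of bipartite entanglement* if there are a simple graph on $\{v_1,\dots,v_8\}$ and, for each edge $e=\{v_k,v_l\}$, an entangled pure state $|\phi_e\rangle$ of a system at $v_k$ and a system at $v_l$, such that $|\phi\rangle$ is the image of $\bigotimes_e|\phi_e\rangle$ under a product of local isometries into the spaces $\overline{\mathcal H}^{v_k}$. It is a *common resource state* for a set $S$ of states of $\mathcal H$ if for each $|\psi\rangle\in S$ some LOCC protocol (with finitely or infinitely many rounds), in which party $v_k$ applies quantum instruments to $\overline{\mathcal H}^{v_k}$ without enlarging it, transforms $|\phi\rangle$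 into $|\psi\rangle$ deterministically and exactly. For a circuit $C$ of seven gates $\exp(\mathrm i\alpha_iZ\otimes Z)$, the $i$-th acting on two distinct qubits $v_{a_i},v_{b_i}$ of $\mathcal H$, let $$S_0(C)=\Bigl\{\prod_{i=1}^{7}\exp\bigl(\mathrm i\alpha_iZ^{v_{a_i}}\otimes Z^{v_{b_i}}\bigr)|+\rangle^{\otimes 8} : 0\le\alpha_i<2\pi\Bigr\},$$ and let $G(C)$ be the graph on $v_1,\dots,v_8$ with the edges $\{v_{a_i},v_{b_i}\}$. 1. For the circuit with gates on $v_1v_2,\ v_3v_4,\ v_5v_6,\ v_7v_8$, then $v_2v_4,\ v_6v_8$, then $v_4v_8$, no state of $\overline{\mathcal H}$ that consists of bipartite entanglement is a common resource state for $S_0(C)$. 2. The same holds for every such circuit $C$ for which $G(C)$ is connected (hence a tree) and the tree obtained from $G(C)$ by hanging a path with two edges on $v_8$ is not a caterpillar, i.e. has a vertex with three arms of length at least two. -/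

import Mathlib

noncomputable section

namespace BipartiteResource

open Filter Topology Matrix

/-! ## Multipartite systems -/

/-- Labels of the product basis of `⊗ₖ ℂ^(d k)`; a vector of that space is its family of
amplitudes `Conf d → ℂ`. -/
abbrev Conf {N : ℕ} (d : Fin N → ℕ) : Type := (k : Fin N) → Fin (d k)

/-- Unit vectors. -/
def IsState {ι : Type*} [Fintype ι] (φ : ι → ℂ) : Prop := ∑ x, ‖φ x‖ ^ 2 = 1

/-- The projector `|φ⟩⟨φ|`. -/
def density {ι : Type*} (φ : ι → ℂ) : Matrix ι ι ℂ := vecMulVec φ (star φ)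

/-- The operator `K` of party `k`, tensored with the identity on all other parties. -/
def localOp {N : ℕ} {d : Fin N → ℕ} (k : Fin N) (K : Matrix (Fin (d k)) (Fin (d k)) ℂ) :
    Matrix (Conf d) (Conf d) ℂ :=
  fun x y => if ∀ j, j ≠ k → x j = y j then K (x k) (y k) else 0

/-! ## LOCC within a configuration of local dimensions -/

/-- A finite LOCC protocol in which party `k` always holds a system of dimension `d k`.
In a step, party `k` applies a quantum instrument to its system: the classical outcome `i`
belongs to the completely positive map with Kraus operators `K i 0, K i 1, …`, and the sum over
all outcomes is trace preserving. The outcome is broadcast, and the continuation may depend on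
it. -/
inductive Protocol {N : ℕ} (d : Fin N → ℕ) : Type
  | done : Protocol d
  | step (k : Fin N) (m : ℕ) (r : Fin m → ℕ)
      (K : (i : Fin m) → Fin (r i) → Matrix (Fin (d k)) (Fin (d k)) ℂ)
      (tracePreserving : ∑ i, ∑ j, (K i j)ᴴ * K i j = 1)
      (next : Fin m → Protocol d) : Protocol d

/-- The output, averaged over all outcomes, of a protocol on an input density operator. -/
def Protocol.run {N : ℕ} {d : Fin N → ℕ} :
    Protocol d → Matrix (Conf d) (Conf d) ℂ → Matrix (Conf d) (Conf d) ℂ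
  | .done, ρ => ρ
  | .step k _ _ K _ next, ρ =>
      ∑ i, (next i).run (∑ j, localOp k (K i j) * ρ * (localOp k (K i j))ᴴ)

/-- `Extends P Q`: the protocol `Q` starts with `P` and possibly goes on after it. -/
inductive Protocol.Extends {N : ℕ} {d : Fin N → ℕ} : Protocol d → Protocol d → Prop
  | done (Q : Protocol d) : Protocol.Extends .done Q
  | step (k : Fin N) (m : ℕ) (r : Fin m → ℕ)
      (K : (i : Fin m) → Fin (r i) → Matrix (Fin (d k)) (Fin (d k)) ℂ)
      (h : ∑ i, ∑ j, (K i j)ᴴ * K i j = 1) (next next' : Fin m → Protocol d)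
      (hnext : ∀ i, Protocol.Extends (next i) (next' i)) :
      Protocol.Extends (.step k m r K h next) (.step k m r K h next')

/-- `φ` is transformed into `ψ` by LOCC, deterministically and exactly. A protocol may have
infinitely many rounds: it is given by longer and longer finite protocols, each of which continues
the preceding one, and its output is the limit of their outputs. A protocol with finitely many
rounds is a constant sequence, and its output then equals `|ψ⟩⟨ψ|`. -/
def LOCCTransforms {N : ℕ} {d : Fin N → ℕ} (φ ψ : Conf d → ℂ) : Prop :=
  ∃ P : ℕ → Protocol d, (∀ n, (P n).Extends (P (n + 1))) ∧
    Tendsto (fun n => (P n).run (density φ)) atTop (𝓝 (density ψ))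

/-- `φ` is a common resource state for the target set `S`. -/
def IsCommonResource {N : ℕ} {d : Fin N → ℕ} (φ : Conf d → ℂ) (S : Set (Conf d → ℂ)) : Prop :=
  ∀ ψ ∈ S, LOCCTransforms φ ψ

/-! ## States consisting of bipartite entanglement -/

/-- A distribution of bipartite entangled states among `N` parties along the edges of a graph.
`dim k l` is the dimension of the system at `k` that belongs to the state shared by `k` and `l`,
and the state of the edge `{k, l}` with `k < l` is `state k l`. The values of `dim` and `state` at
other pairs are not used. -/
structure Distribution (N : ℕ) where
  graph : SimpleGraph (Fin N)
  dim : Fin N → Fin N → ℕ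
  state : (k l : Fin N) → Fin (dim k l) → Fin (dim l k) → ℂ
  normalized : ∀ k l, k < l → graph.Adj k l → ∑ a, ∑ b, ‖state k l a b‖ ^ 2 = 1
  entangled : ∀ k l, k < l → graph.Adj k l →
    ¬ ∃ (f : Fin (dim k l) → ℂ) (g : Fin (dim l k) → ℂ), ∀ a b, state k l a b = f a * g b

namespace Distribution

/-- Basis labels of the systems that party `k` holds, one for each edge at `k`. -/
abbrev Local {N : ℕ} (D : Distribution N) (k : Fin N) : Type :=
  (l : {l : Fin N // D.graph.Adj k l}) → Fin (D.dim k l)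

/-- The edges, oriented from the smaller to the larger end. -/
abbrev Edge {N : ℕ} (D : Distribution N) : Type :=
  {p : Fin N × Fin N // p.1 < p.2 ∧ D.graph.Adj p.1 p.2}

open Classical in
/-- The tensor product of the states of all edges. -/
def amplitude {N : ℕ} (D : Distribution N) (y : (k : Fin N) → D.Local k) : ℂ :=
  ∏ e : D.Edge, D.state e.1.1 e.1.2 (y e.1.1 ⟨e.1.2, e.2.2⟩) (y e.1.2 ⟨e.1.1, e.2.2.symm⟩)

end Distribution

open Classical in
/-- `φ` is, up to a local isometry at each party (an embedding into the party's system followed by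
a local unitary), a tensor product of bipartite entangled states along the edges of a graph. -/
def ConsistsOfBipartite {N : ℕ} {d : Fin N → ℕ} (φ : Conf d → ℂ) : Prop :=
  ∃ (D : Distribution N) (W : (k : Fin N) → Matrix (Fin (d k)) (D.Local k) ℂ),
    (∀ k, (W k)ᴴ * W k = 1) ∧
    ∀ x, φ x = ∑ y : ((k : Fin N) → D.Local k), (∏ k, W k (x k) (y k)) * D.amplitude y

/-! ## The configuration and the target sets -/

/-- Eight parties; the last one holds one qubit, the others have dimension four. -/
def d₀ : Fin 8 → ℕ := ![4, 4, 4, 4, 4, 4, 4, 2]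

/-- The basis labels of eight qubits. -/
abbrev Qubits : Type := Conf (fun _ : Fin 8 => 2)

/-- The placement of seven two-qubit gates on eight wires. -/
structure Circuit where
  fst : Fin 7 → Fin 8
  snd : Fin 7 → Fin 8
  ne : ∀ i, fst i ≠ snd i

/-- The Pauli operator `Z`. -/
def pauliZ : Matrix (Fin 2) (Fin 2) ℂ := !![1, 0; 0, -1]

/-- `|+⟩^{⊗8}`. -/
def plus : Qubits → ℂ := fun _ => ∏ _k : Fin 8, ((1 / Real.sqrt 2 : ℝ) : ℂ)

/-- The gate `exp(i t Z ⊗ Z)` on the wires `a` and `b`. -/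
def zzGate (a b : Fin 8) (t : ℝ) : Matrix Qubits Qubits ℂ :=
  NormedSpace.exp ((Complex.I * (t : ℂ)) •
    (localOp (d := fun _ : Fin 8 => 2) a pauliZ * localOp (d := fun _ : Fin 8 => 2) b pauliZ))

namespace Circuit

/-- The output `ψ(α)` of the circuit on `|+⟩^{⊗8}`; the gate with index `0` acts first. -/
def output (C : Circuit) (α : Fin 7 → ℝ) : Qubits → ℂ :=
  (List.ofFn fun i => zzGate (C.fst i) (C.snd i) (α i)).reverse.prod *ᵥ plus

/-- All outputs of the circuit. -/
def outputs (C : Circuit) : Set (Qubits → ℂ) :=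
  {ψ | ∃ α : Fin 7 → ℝ, (∀ i, 0 ≤ α i ∧ α i < 2 * Real.pi) ∧ ψ = C.output α}

/-- The graph on the parties whose edges are the pairs of wires joined by a gate. -/
def interaction (C : Circuit) : SimpleGraph (Fin 8) where
  Adj x y := ∃ i, (C.fst i = x ∧ C.snd i = y) ∨ (C.fst i = y ∧ C.snd i = x)
  symm := ⟨fun _ _ ⟨i, h⟩ => ⟨i, h.symm⟩⟩
  loopless := ⟨fun _ ⟨i, h⟩ => C.ne i (h.elim (fun h => h.1.trans h.2.symm)
    (fun h => h.1.trans h.2.symm))⟩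

/-- `x` starts an arm of length at least two at `w` in the graph that arises from the interaction
graph when a path with two edges is hung on the last party. -/
def LongArm (C : Circuit) (w x : Fin 8) : Prop :=
  C.interaction.Adj w x ∧ (x = 7 ∨ ∃ y, y ≠ w ∧ C.interaction.Adj x y)

/-- In the interaction graph with a path of two edges hung on the last party, some party has three
arms of length at least two. (At the last party itself the path hung on it is one of them.)
For a tree, this says that the extended tree is not a caterpillar. -/
def Branching (C : Circuit) : Prop :=
  ∃ w, 3 ≤ {x | C.LongArm w x}.ncard + if w = 7 then 1 else 0

end Circuit

/-- Three layers with four, two and one gates: gates join `v₁v₂`, `v₃v₄`, `v₅v₆`, `v₇v₈`, then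
`v₂v₄`, `v₆v₈`, and then `v₄v₈`. -/
def layeredCircuit : Circuit where
  fst := ![0, 2, 4, 6, 1, 5, 3]
  snd := ![1, 3, 5, 7, 3, 7, 7]
  ne := by decide

/-- The inclusion of the eight qubits into the total system; the qubit of each party is spanned by
the first two basis vectors of its system. -/
def embed {d : Fin 8 → ℕ} (ψ : Qubits → ℂ) : Conf d → ℂ :=
  fun x => if h : ∀ k, (x k : ℕ) < 2 then ψ (fun k => ⟨x k, h k⟩) else 0

/-- The target set `S₀` of a circuit, within the total system. -/
def targetSet (C : Circuit) : Set (Conf d₀ → ℂ) := embed '' C.outputs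

/-- Some resource state that consists of bipartite entanglement and fits within the local
dimensions `d` is a common resource state for `S`. -/
def AchievableByBipartite (d : Fin 8 → ℕ) (S : Set (Conf d → ℂ)) : Prop :=
  ∃ φ : Conf d → ℂ, IsState φ ∧ ConsistsOfBipartite φ ∧ IsCommonResource φ S

end BipartiteResource

end

/-! The obstruction is Schmidt rank across cuts. No LOCC protocol, even in the limit of infinitely
many rounds, raises it (`LOCCTransforms.cutRank_le`), so the resource must have at least the rank of
every target across every cut.

Each edge of the resource graph takes a factor of at least 2 of the dimension at both ends. Hence
the last party has at most one edge and the others at most two. Since the interaction graph is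
connected, some gate crosses any cut that splits the parties, so the resource graph is connected
too. It is therefore a path starting at the last party. Cutting it after a party leaves one crossing
edge, of dimension at most 2 on the near side: the last party has dimension 2, and an inner party
has dimension at most 4 and spends a factor of 2 on its other edge. All these cuts have rank at most
2.

Two disjoint gates across a cut at angle π/4 would give rank 4. So the path lays out the interaction
tree on a line with disjoint edges in disjoint intervals. This persists when a path is hung on the
last party, which sits at the end of the line, and it rules out a vertex with three long arms
(`Circuit.not_branching_of_layout`). -/

noncomputable section

namespace BipartiteResource

open Filter Topology Matrix

/-! ## Rank across a cut -/

section CutRank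

variable {ι : Type*} [Fintype ι] [DecidableEq ι] {β γ : ι → Type*}
  [∀ i, Fintype (β i)]

/-- The amplitudes `χ` as a matrix whose rows are labelled by the parties satisfying `p` and whose
columns are labelled by the other ones. -/
def cutMatrix (p : ι → Prop) [DecidablePred p] (χ : ((i : ι) → β i) → ℂ) :
    Matrix ((i : {i // p i}) → β i) ((i : {i // ¬ p i}) → β i) ℂ :=
  fun u v => χ ((Equiv.piEquivPiSubtypeProd p β).symm (u, v))

/-- The Schmidt rank of `χ` across a cut. -/
def cutRank (p : ι → Prop) [DecidablePred p] (χ : ((i : ι) → β i) → ℂ) : ℕ :=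
  (cutMatrix p χ).rank

/-- The tensor product of the local operators `W i`, applied to `χ`. -/
def tensorApply (W : (i : ι) → Matrix (γ i) (β i) ℂ) (χ : ((i : ι) → β i) → ℂ) :
    ((i : ι) → γ i) → ℂ :=
  fun x => ∑ y : ((i : ι) → β i), (∏ i, W i (x i) (y i)) * χ y

variable (p : ι → Prop) [DecidablePred p]

/-- A product operator splits into a factor for each side of the cut, so it multiplies the cut
matrix from the left and from the right; rank monotonicity follows. -/
theorem cutMatrix_tensorApply (W : (i : ι) → Matrix (γ i) (β i) ℂ)
    (χ : ((i : ι) → β i) → ℂ) :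
    cutMatrix p (tensorApply W χ) =
      (of fun (x : (i : {i // p i}) → γ i) (u : (i : {i // p i}) → β i) =>
          ∏ i : {i // p i}, W i (x i) (u i)) * cutMatrix p χ *
        (of fun (v : (i : {i // ¬ p i}) → β i) (x : (i : {i // ¬ p i}) → γ i) =>
          ∏ i : {i // ¬ p i}, W i (x i) (v i)) := by
  ext x x'
  simp only [cutMatrix, tensorApply, mul_apply, of_apply, Finset.sum_mul]
  rw [← (Equiv.piEquivPiSubtypeProd p β).symm.sum_comp, Fintype.sum_prod_type, Finset.sum_comm]
  refine Finset.sum_congr rfl fun v _ => Finset.sum_congr rfl fun u _ => ?_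
  rw [← Fintype.prod_subtype_mul_prod_subtype p]
  have h1 : ∀ i : {i // p i}, W i ((Equiv.piEquivPiSubtypeProd p γ).symm (x, x') i)
      ((Equiv.piEquivPiSubtypeProd p β).symm (u, v) i) = W i (x i) (u i) := fun i => by
    simp [Equiv.piEquivPiSubtypeProd, i.2]
  have h2 : ∀ i : {i // ¬ p i}, W i ((Equiv.piEquivPiSubtypeProd p γ).symm (x, x') i)
      ((Equiv.piEquivPiSubtypeProd p β).symm (u, v) i) = W i (x' i) (v i) := fun i => by
    simp [Equiv.piEquivPiSubtypeProd, i.2]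
  simp only [h1, h2]
  ring

theorem cutRank_tensorApply_le [∀ i, Fintype (γ i)] (W : (i : ι) → Matrix (γ i) (β i) ℂ)
    (χ : ((i : ι) → β i) → ℂ) : cutRank p (tensorApply W χ) ≤ cutRank p χ := by
  rw [cutRank, cutMatrix_tensorApply]
  exact (rank_mul_le_left _ _).trans (rank_mul_le_right _ _)

theorem cutRank_smul_le (c : ℂ) (χ : ((i : ι) → β i) → ℂ) :
    cutRank p (c • χ) ≤ cutRank p χ := by
  have h : cutMatrix p (c • χ) = c • cutMatrix p χ := rfl
  rw [cutRank, cutRank, h]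
  rcases eq_or_ne c 0 with rfl | hc
  · simp
  · exact (rank_smul_of_mem_nonZeroDivisors _ (mem_nonZeroDivisors_of_ne_zero hc)).le

/-- Lower semicontinuity of the rank, pulled back along the linear map from amplitudes to operators.
-/
theorem isOpen_setOf_le_cutRank (n : ℕ) :
    IsOpen {χ : ((i : ι) → β i) → ℂ | n ≤ cutRank p χ} := by
  let Λ : (((i : ι) → β i) → ℂ) →ₗ[ℂ]
      (((i : {i // ¬ p i}) → β i) → ℂ) →L[ℂ] (((i : {i // p i}) → β i) → ℂ) :=
    { toFun := fun χ => LinearMap.toContinuousLinearMap (cutMatrix p χ).mulVecLin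
      map_add' := fun a b => by
        have : cutMatrix p (a + b) = cutMatrix p a + cutMatrix p b := rfl
        rw [this, Matrix.mulVecLin_add, map_add]
      map_smul' := fun c a => by
        have : (cutMatrix p (c • a)).mulVecLin = c • (cutMatrix p a).mulVecLin := by
          ext1 v
          exact smul_mulVec c (cutMatrix p a) _
        rw [this, map_smul, RingHom.id_apply] }
  have h := (isOpen_setOfPred_nat_le_rank (𝕜 := ℂ) (E := ((i : {i // ¬ p i}) → β i) → ℂ)
    (F := ((i : {i // p i}) → β i) → ℂ) n).preimage Λ.continuous_of_finiteDimensional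
  convert h using 1
  ext χ
  have : (Λ χ).toLinearMap.rank = ((cutMatrix p χ).rank : Cardinal) := by
    rw [Matrix.rank, Module.finrank_eq_rank]
    rfl
  change n ≤ _ ↔ (n : Cardinal) ≤ (Λ χ).toLinearMap.rank
  rw [this, Nat.cast_le]
  rfl

end CutRank

/-! ## The rank across a cut is monotone under LOCC -/

/-- A vector of small rank across a cut has overlap bounded away from one with a vector of large
rank. -/
theorem exists_overlap_bound {ι : Type*} [Fintype ι] [DecidableEq ι] {β : ι → Type*}
    [∀ i, Fintype (β i)] (p : ι → Prop) [DecidablePred p] (r : ℕ)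
    (ψ : ((i : ι) → β i) → ℂ) (hψ : r < cutRank p ψ) :
    ∃ c : ℝ, c < ‖WithLp.toLp 2 ψ‖ ^ 2 ∧ ∀ χ : ((i : ι) → β i) → ℂ, cutRank p χ ≤ r →
      ‖star ψ ⬝ᵥ χ‖ ^ 2 ≤ c * ‖WithLp.toLp 2 χ‖ ^ 2 := by
  have hopen : IsOpen {x : EuclideanSpace ℂ ((i : ι) → β i) | r + 1 ≤ cutRank p x.ofLp} :=
    (isOpen_setOf_le_cutRank p (r + 1)).preimage (PiLp.continuous_ofLp 2 _)
  obtain ⟨δ, hδ, hball⟩ := Metric.isOpen_iff.1 hopen (WithLp.toLp 2 ψ) hψ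
  refine ⟨‖WithLp.toLp 2 ψ‖ ^ 2 - δ ^ 2, by nlinarith, fun χ hχ => ?_⟩
  by_cases h0 : χ = 0
  · simp [h0]
  set x : EuclideanSpace ℂ ((i : ι) → β i) := WithLp.toLp 2 χ with hx
  set y : EuclideanSpace ℂ ((i : ι) → β i) := WithLp.toLp 2 ψ with hy
  have hxpos : 0 < ‖x‖ ^ 2 := by
    have : x ≠ 0 := fun h => h0 (by simpa [hx] using h)
    positivity
  have hin : star ψ ⬝ᵥ χ = inner ℂ y x := by
    rw [EuclideanSpace.inner_eq_star_dotProduct, dotProduct_comm]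
  rw [hin]
  -- `t • x` is the orthogonal projection of `y` onto the line of `x`. Scaling does not raise the
  -- rank, so it stays outside the ball of radius `δ`; Pythagoras turns this distance into the
  -- overlap bound.
  set t : ℂ := inner ℂ x y / ((‖x‖ ^ 2 : ℝ) : ℂ) with ht
  have hfar : δ ≤ ‖y - t • x‖ := by
    by_contra hlt
    have hmem : t • x ∈ Metric.ball y δ := by
      rw [mem_ball_iff_norm, norm_sub_rev]
      exact not_le.1 hlt
    have h1 : r + 1 ≤ cutRank p (t • χ) := hball hmem
    have := cutRank_smul_le p t χ
    omega
  have hexp : ‖y - t • x‖ ^ 2 = ‖y‖ ^ 2 - ‖inner ℂ y x‖ ^ 2 / ‖x‖ ^ 2 := by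
    have hre : RCLike.re (inner ℂ y (t • x)) = ‖inner ℂ y x‖ ^ 2 / ‖x‖ ^ 2 := by
      rw [inner_smul_right, ht, div_mul_eq_mul_div, ← inner_conj_symm x y, mul_comm,
        RCLike.mul_conj]
      change (((‖inner ℂ y x‖ : ℝ) : ℂ) ^ 2 / ((‖x‖ ^ 2 : ℝ) : ℂ)).re = _
      rw [← Complex.ofReal_pow, ← Complex.ofReal_div, Complex.ofReal_re]
    have hn : ‖t • x‖ ^ 2 = ‖inner ℂ y x‖ ^ 2 / ‖x‖ ^ 2 := by
      rw [norm_smul, ht, norm_div, Complex.norm_real, Real.norm_of_nonneg hxpos.le,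
        norm_inner_symm x y]
      field_simp
    rw [@norm_sub_sq ℂ, hre, hn]
    ring
  have hsq : δ ^ 2 ≤ ‖y - t • x‖ ^ 2 := by gcongr
  rw [hexp] at hsq
  have := (div_le_iff₀ hxpos).1 (show ‖inner ℂ y x‖ ^ 2 / ‖x‖ ^ 2 ≤ ‖y‖ ^ 2 - δ ^ 2 by linarith)
  exact this

section LOCC

variable {N : ℕ} {d : Fin N → ℕ}

/-- Sums of projectors onto (unnormalized) vectors of rank at most `r` across a cut. -/
def lowRankCone (d : Fin N → ℕ) (p : Fin N → Prop) [DecidablePred p] (r : ℕ) :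
    AddSubmonoid (Matrix (Conf d) (Conf d) ℂ) :=
  AddSubmonoid.closure (density '' {χ | cutRank p χ ≤ r})

theorem localOp_mulVec (k : Fin N) (K : Matrix (Fin (d k)) (Fin (d k)) ℂ) (χ : Conf d → ℂ) :
    localOp k K *ᵥ χ =
      tensorApply (Function.update (fun j => (1 : Matrix (Fin (d j)) (Fin (d j)) ℂ)) k K) χ := by
  ext x
  simp only [mulVec, dotProduct, tensorApply]
  refine Finset.sum_congr rfl fun y _ => ?_
  congr 1
  rw [← Finset.mul_prod_erase _ _ (Finset.mem_univ k), Function.update_self]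
  have : ∏ j ∈ Finset.univ.erase k,
      Function.update (fun j => (1 : Matrix (Fin (d j)) (Fin (d j)) ℂ)) k K j (x j) (y j) =
      if ∀ j, j ≠ k → x j = y j then 1 else 0 := by
    rw [Finset.prod_congr rfl fun j hj => by
      rw [Function.update_of_ne (Finset.ne_of_mem_erase hj), Matrix.one_apply]]
    rw [Finset.prod_ite_zero]
    simp
  rw [this, localOp]
  split_ifs <;> simp

theorem mul_density_mul (A : Matrix (Conf d) (Conf d) ℂ) (χ : Conf d → ℂ) :
    A * density χ * Aᴴ = density (A *ᵥ χ) := by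
  rw [density, density, mul_vecMulVec, vecMulVec_mul, star_mulVec]

variable (p : Fin N → Prop) [DecidablePred p] (r : ℕ)

/-- A single Kraus operator sends a projector onto a vector to another such projector, whose vector
has no larger rank; sums follow by additivity. -/
theorem localOp_conj_mem_lowRankCone (k : Fin N) (K : Matrix (Fin (d k)) (Fin (d k)) ℂ)
    {ρ : Matrix (Conf d) (Conf d) ℂ} (hρ : ρ ∈ lowRankCone d p r) :
    localOp k K * ρ * (localOp k K)ᴴ ∈ lowRankCone d p r := by
  induction hρ using AddSubmonoid.closure_induction with
  | mem ρ h =>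
    obtain ⟨χ, hχ, rfl⟩ := h
    rw [mul_density_mul]
    refine AddSubmonoid.subset_closure ⟨_, ?_, rfl⟩
    rw [Set.mem_ofPred_eq, localOp_mulVec]
    exact (cutRank_tensorApply_le p _ _).trans hχ
  | zero => simp
  | add a b _ _ ha hb =>
    rw [mul_add, add_mul]
    exact add_mem ha hb

theorem Protocol.run_mem_lowRankCone (P : Protocol d) {ρ : Matrix (Conf d) (Conf d) ℂ}
    (hρ : ρ ∈ lowRankCone d p r) : P.run ρ ∈ lowRankCone d p r := by
  induction P generalizing ρ with
  | done => exact hρ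
  | step k m s K h next ih =>
    exact sum_mem fun i _ => ih i (sum_mem fun j _ => localOp_conj_mem_lowRankCone p r k _ hρ)

theorem cutRank_le_of_tendsto {ψ : Conf d → ℂ} {ρ : ℕ → Matrix (Conf d) (Conf d) ℂ}
    (hρ : ∀ n, ρ n ∈ lowRankCone d p r) (hlim : Tendsto ρ atTop (𝓝 (density ψ))) :
    cutRank p ψ ≤ r := by
  by_contra! hlt
  obtain ⟨c, hc, hbound⟩ := exists_overlap_bound p r ψ hlt
  -- A witness functional: continuous, additive, nonnegative on the cone by the overlap bound, but
  -- negative at `density ψ`, where it equals `c‖ψ‖² - ‖ψ‖⁴`. So no closedness of the cone is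
  -- needed.
  let L : Matrix (Conf d) (Conf d) ℂ → ℝ := fun ρ =>
    c * ρ.trace.re - (star ψ ⬝ᵥ (ρ *ᵥ ψ)).re
  have hLcont : Continuous L := by
    unfold L
    fun_prop
  have hLd : ∀ χ : Conf d → ℂ,
      L (density χ) = c * ‖WithLp.toLp 2 χ‖ ^ 2 - ‖star ψ ⬝ᵥ χ‖ ^ 2 := fun χ => by
    have h1 : (density χ).trace.re = ‖WithLp.toLp 2 χ‖ ^ 2 := by
      rw [density, trace_vecMulVec, EuclideanSpace.norm_sq_eq, dotProduct, Complex.re_sum]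
      refine Finset.sum_congr rfl fun x _ => ?_
      rw [Pi.star_apply, RCLike.star_def, RCLike.mul_conj]
      norm_cast
    have h2 : (star ψ ⬝ᵥ (density χ *ᵥ ψ)).re = ‖star ψ ⬝ᵥ χ‖ ^ 2 := by
      have : star χ ⬝ᵥ ψ = star (star ψ ⬝ᵥ χ) := by
        rw [star_dotProduct]
      rw [density, vecMulVec_mulVec, dotProduct_smul, MulOpposite.smul_eq_mul_unop,
        MulOpposite.unop_op, this, RCLike.star_def, RCLike.mul_conj]
      norm_cast
    simp only [L, h1, h2]
  have hLadd : ∀ a b, L (a + b) = L a + L b := fun a b => by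
    simp only [L, trace_add, Complex.add_re, add_mulVec, dotProduct_add]
    ring
  have hLnonneg : ∀ a ∈ lowRankCone d p r, 0 ≤ L a := fun a ha => by
    induction ha using AddSubmonoid.closure_induction with
    | mem a h =>
      obtain ⟨χ, hχ, rfl⟩ := h
      rw [hLd]
      linarith [hbound χ hχ]
    | zero => simp [L]
    | add a b _ _ ha hb =>
      rw [hLadd]
      exact add_nonneg ha hb
  have h0 : 0 ≤ L (density ψ) :=
    ge_of_tendsto' ((hLcont.tendsto _).comp hlim) fun n => hLnonneg _ (hρ n)
  rw [hLd] at h0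
  have hself : ‖star ψ ⬝ᵥ ψ‖ = ‖WithLp.toLp 2 ψ‖ ^ 2 := by
    rw [dotProduct_comm, ← EuclideanSpace.inner_toLp_toLp, inner_self_eq_norm_sq_to_K]
    simp
  have hpos : 0 < ‖WithLp.toLp 2 ψ‖ ^ 2 := by
    have : WithLp.toLp 2 ψ ≠ 0 := fun h => by
      have h' : ψ = 0 := by simpa using h
      have hz : cutMatrix p ψ = 0 := by rw [h']; rfl
      rw [cutRank, hz, rank_zero] at hlt
      omega
    positivity
  rw [hself] at h0
  nlinarith

theorem LOCCTransforms.cutRank_le {φ ψ : Conf d → ℂ} (h : LOCCTransforms φ ψ) :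
    cutRank p ψ ≤ cutRank p φ := by
  obtain ⟨P, -, hlim⟩ := h
  exact cutRank_le_of_tendsto p _ (fun n => (P n).run_mem_lowRankCone p _
    (AddSubmonoid.subset_closure ⟨φ, Set.mem_ofPred.2 le_rfl, rfl⟩)) hlim

end LOCC

/-! ## Resource states -/

theorem rank_le_of_eq_mul_left {m n : Type*} [Fintype m] [Fintype n] {A B : Matrix m n ℂ}
    (F : m → ℂ) (h : ∀ i j, A i j = B i j * F i) : A.rank ≤ B.rank := by
  classical
  have : A = diagonal F * B := by
    ext i j
    rw [diagonal_mul, h, mul_comm]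
  rw [this]
  exact rank_mul_le_right _ _

theorem rank_le_of_eq_mul_right {m n : Type*} [Fintype m] [Fintype n] {A B : Matrix m n ℂ}
    (F : n → ℂ) (h : ∀ i j, A i j = B i j * F j) : A.rank ≤ B.rank := by
  classical
  have : A = B * diagonal F := by
    ext i j
    rw [mul_diagonal, h]
  rw [this]
  exact rank_mul_le_left _ _

theorem piEquivPiSubtypeProd_symm_pos {ι : Type*} {β : ι → Type*} (p : ι → Prop)
    [DecidablePred p] (u : (i : {i // p i}) → β i) (v : (i : {i // ¬ p i}) → β i) {i : ι}
    (hi : p i) : (Equiv.piEquivPiSubtypeProd p β).symm (u, v) i = u ⟨i, hi⟩ := by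
  simp [Equiv.piEquivPiSubtypeProd, hi]

theorem piEquivPiSubtypeProd_symm_neg {ι : Type*} {β : ι → Type*} (p : ι → Prop)
    [DecidablePred p] (u : (i : {i // p i}) → β i) (v : (i : {i // ¬ p i}) → β i) {i : ι}
    (hi : ¬ p i) : (Equiv.piEquivPiSubtypeProd p β).symm (u, v) i = v ⟨i, hi⟩ := by
  simp [Equiv.piEquivPiSubtypeProd, hi]

namespace Distribution

variable {N : ℕ} (D : Distribution N)

/-- With at most one basis label at one end, every bipartite state is a product. -/
theorem two_le_dim {k l : Fin N} (h : D.graph.Adj k l) : 2 ≤ D.dim k l := by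
  by_contra! hlt
  have hsub : Subsingleton (Fin (D.dim k l)) := by
    rw [Fin.subsingleton_iff_le_one]
    omega
  rcases lt_or_gt_of_ne h.ne with hkl | hkl
  · refine D.entangled k l hkl h ?_
    by_cases hne : Nonempty (Fin (D.dim k l))
    · obtain ⟨a₀⟩ := hne
      exact ⟨fun _ => 1, fun b => D.state k l a₀ b, fun a b => by
        rw [one_mul, Subsingleton.elim a a₀]⟩
    · exact ⟨fun _ => 0, fun _ => 0, fun a => (hne ⟨a⟩).elim⟩
  · refine D.entangled l k hkl h.symm ?_
    by_cases hne : Nonempty (Fin (D.dim k l))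
    · obtain ⟨b₀⟩ := hne
      exact ⟨fun a => D.state l k a b₀, fun _ => 1, fun a b => by
        rw [mul_one, Subsingleton.elim b b₀]⟩
    · exact ⟨fun _ => 0, fun _ => 0, fun _ b => (hne ⟨b⟩).elim⟩

open Classical in
theorem card_local_le {d : ℕ} {k : Fin N} (W : Matrix (Fin d) (D.Local k) ℂ)
    (hW : Wᴴ * W = 1) : Fintype.card (D.Local k) ≤ d := by
  calc Fintype.card (D.Local k) = (Wᴴ * W).rank := by rw [hW, rank_one]
    _ ≤ W.rank := rank_mul_le_right _ _
    _ ≤ d := (rank_le_card_height W).trans (by simp)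

-- The omitted edges at `k` contribute factors of at least 1. Together with the isometry bound, this
-- limits degrees and edge dimensions.
open Classical in
theorem prod_dim_le_card_local {k : Fin N} (s : Finset (Fin N))
    (hs : ∀ l ∈ s, D.graph.Adj k l) : ∏ l ∈ s, D.dim k l ≤ Fintype.card (D.Local k) := by
  have h1 : Fintype.card (D.Local k) = ∏ l : {l // D.graph.Adj k l}, D.dim k l := by
    rw [Fintype.card_pi]
    simp
  rw [h1, ← Finset.prod_subtype (Finset.univ.filter fun l => D.graph.Adj k l) (by simp)
    (fun l => D.dim k l)]
  refine Finset.prod_le_prod_of_subset_of_one_le' (fun l hl => by simpa using hs l hl)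
    fun l hl _ => ?_
  have := D.two_le_dim (k := k) (l := l) (by simpa using hl)
  omega

/-- The factor of an edge in the tensor product of the states of all edges. -/
def edgeFactor (e : D.Edge) (y : (k : Fin N) → D.Local k) : ℂ :=
  D.state e.1.1 e.1.2 (y e.1.1 ⟨e.1.2, e.2.2⟩) (y e.1.2 ⟨e.1.1, e.2.2.symm⟩)

variable (p : Fin N → Prop) [DecidablePred p]

-- An edge inside one side depends on the row label alone or on the column label alone, so it only
-- rescales rows or columns.
open Classical in
theorem cutRank_mul_edgeFactor_le (χ : ((k : Fin N) → D.Local k) → ℂ) (e : D.Edge)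
    (he : p e.1.1 ↔ p e.1.2) :
    cutRank p (fun y => χ y * D.edgeFactor e y) ≤ cutRank p χ := by
  by_cases h : p e.1.1
  · refine rank_le_of_eq_mul_left (fun u => D.state e.1.1 e.1.2
      (u ⟨e.1.1, h⟩ ⟨e.1.2, e.2.2⟩) (u ⟨e.1.2, he.1 h⟩ ⟨e.1.1, e.2.2.symm⟩)) fun u v => ?_
    simp only [cutMatrix, edgeFactor, piEquivPiSubtypeProd_symm_pos p u v h,
      piEquivPiSubtypeProd_symm_pos p u v (he.1 h)]
  · have h' : ¬ p e.1.2 := fun hh => h (he.2 hh)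
    refine rank_le_of_eq_mul_right (fun v => D.state e.1.1 e.1.2
      (v ⟨e.1.1, h⟩ ⟨e.1.2, e.2.2⟩) (v ⟨e.1.2, h'⟩ ⟨e.1.1, e.2.2.symm⟩)) fun u v => ?_
    simp only [cutMatrix, edgeFactor, piEquivPiSubtypeProd_symm_neg p u v h,
      piEquivPiSubtypeProd_symm_neg p u v h']

open Classical in
theorem cutRank_mul_prod_edgeFactor_le (χ : ((k : Fin N) → D.Local k) → ℂ)
    (s : Finset D.Edge) (hs : ∀ e ∈ s, p e.1.1 ↔ p e.1.2) :
    cutRank p (fun y => χ y * ∏ e ∈ s, D.edgeFactor e y) ≤ cutRank p χ := by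
  induction s using Finset.induction_on with
  | empty => simp
  | insert e s he ih =>
    have h1 := D.cutRank_mul_edgeFactor_le p (fun y => χ y * ∏ e ∈ s, D.edgeFactor e y) e
      (hs e (Finset.mem_insert_self e s))
    have h2 : (fun y => χ y * ∏ e ∈ insert e s, D.edgeFactor e y) =
        fun y => (χ y * ∏ e ∈ s, D.edgeFactor e y) * D.edgeFactor e y := by
      ext y
      rw [Finset.prod_insert he]
      ring
    rw [h2]
    exact h1.trans (ih fun e h => hs e (Finset.mem_insert_of_mem h))

open Classical in
theorem cutRank_amplitude_le_one (h : ∀ a b, D.graph.Adj a b → (p a ↔ p b)) :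
    cutRank p D.amplitude ≤ 1 := by
  have h1 : D.amplitude = fun y => (fun _ => 1) y * ∏ e ∈ Finset.univ, D.edgeFactor e y := by
    ext y
    rw [one_mul]
    rfl
  rw [h1]
  refine (D.cutRank_mul_prod_edgeFactor_le p _ _ fun e _ => h _ _ e.2.2).trans ?_
  have h2 : cutMatrix p (fun _ : (k : Fin N) → D.Local k => (1 : ℂ)) =
      vecMulVec (fun _ => 1) (fun _ => 1) := by
    ext u v
    exact (one_mul 1).symm
  rw [cutRank, h2]
  exact rank_vecMulVec_le _ _

-- For a crossing edge the cut matrix is the matrix of its amplitudes, or the transpose, with rows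
-- and columns repeated or dropped.
open Classical in
theorem cutRank_edgeFactor_le (e : D.Edge) (he : ¬ (p e.1.1 ↔ p e.1.2)) :
    cutRank p (D.edgeFactor e) ≤ min (D.dim e.1.1 e.1.2) (D.dim e.1.2 e.1.1) := by
  by_cases h : p e.1.1
  · have h' : ¬ p e.1.2 := fun hh => he ⟨fun _ => hh, fun _ => h⟩
    have h1 : cutMatrix p (D.edgeFactor e) =
        (of (D.state e.1.1 e.1.2)).submatrix (fun u => u ⟨e.1.1, h⟩ ⟨e.1.2, e.2.2⟩)
          (fun v => v ⟨e.1.2, h'⟩ ⟨e.1.1, e.2.2.symm⟩) := by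
      ext u v
      simp only [cutMatrix, edgeFactor, piEquivPiSubtypeProd_symm_pos p u v h,
        piEquivPiSubtypeProd_symm_neg p u v h', submatrix_apply, of_apply]
    rw [cutRank, h1]
    exact (rank_submatrix_le _ _ _).trans
      (le_min ((rank_le_card_height _).trans (by simp)) ((rank_le_card_width _).trans (by simp)))
  · have h' : p e.1.2 := by_contra fun hh => he ⟨fun x => (h x).elim, fun x => (hh x).elim⟩
    have h1 : cutMatrix p (D.edgeFactor e) =
        (of (D.state e.1.1 e.1.2))ᵀ.submatrix (fun u => u ⟨e.1.2, h'⟩ ⟨e.1.1, e.2.2.symm⟩)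
          (fun v => v ⟨e.1.1, h⟩ ⟨e.1.2, e.2.2⟩) := by
      ext u v
      simp only [cutMatrix, edgeFactor, piEquivPiSubtypeProd_symm_neg p u v h,
        piEquivPiSubtypeProd_symm_pos p u v h', submatrix_apply, transpose_apply, of_apply]
    rw [cutRank, h1]
    exact (rank_submatrix_le _ _ _).trans
      (le_min ((rank_le_card_width _).trans (by simp)) ((rank_le_card_height _).trans (by simp)))

open Classical in
theorem cutRank_amplitude_le_dim {a b : Fin N} (hab : D.graph.Adj a b) (ha : p a) (hb : ¬ p b)
    (huniq : ∀ c e, D.graph.Adj c e → p c → ¬ p e → c = a ∧ e = b) :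
    cutRank p D.amplitude ≤ D.dim a b := by
  obtain ⟨e₀, he₀, hdim⟩ : ∃ e : D.Edge, (∀ f : D.Edge, f ≠ e → (p f.1.1 ↔ p f.1.2)) ∧
      cutRank p (D.edgeFactor e) ≤ D.dim a b := by
    -- Edges are stored from the smaller to the larger end, so `a` may be either component.
    rcases lt_or_gt_of_ne hab.ne with h | h
    · refine ⟨⟨(a, b), h, hab⟩, fun f hf => ?_, (D.cutRank_edgeFactor_le p ⟨(a, b), h, hab⟩
        (by tauto)).trans (min_le_left _ _)⟩
      by_contra hne
      by_cases h1 : p f.1.1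
      · obtain ⟨h2, h3⟩ := huniq _ _ f.2.2 h1 (by tauto)
        exact hf (Subtype.ext (Prod.ext h2 h3))
      · obtain ⟨h2, h3⟩ := huniq _ _ f.2.2.symm (by tauto) h1
        have := f.2.1
        rw [h2, h3] at this
        exact lt_asymm this h
    · refine ⟨⟨(b, a), h, hab.symm⟩, fun f hf => ?_,
        (D.cutRank_edgeFactor_le p ⟨(b, a), h, hab.symm⟩ (by tauto)).trans (min_le_right _ _)⟩
      by_contra hne
      by_cases h1 : p f.1.1
      · obtain ⟨h2, h3⟩ := huniq _ _ f.2.2 h1 (by tauto)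
        have := f.2.1
        rw [h2, h3] at this
        exact lt_asymm this h
      · obtain ⟨h2, h3⟩ := huniq _ _ f.2.2.symm (by tauto) h1
        exact hf (Subtype.ext (Prod.ext h3 h2))
  have h1 : D.amplitude = fun y => D.edgeFactor e₀ y *
      ∏ e ∈ Finset.univ.erase e₀, D.edgeFactor e y := by
    ext y
    rw [Finset.mul_prod_erase _ (fun e => D.edgeFactor e y) (Finset.mem_univ e₀)]
    rfl
  rw [h1]
  exact (D.cutRank_mul_prod_edgeFactor_le p _ _ fun e he =>
    he₀ e (Finset.ne_of_mem_erase he)).trans hdim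

end Distribution

/-! ## Target states -/

/-- The eigenvalue of `Z` at a basis label. -/
def sgn (a : Fin 2) : ℂ := pauliZ a a

theorem localOp_pauliZ (a : Fin 8) :
    localOp (d := fun _ : Fin 8 => 2) a pauliZ = diagonal fun x => sgn (x a) := by
  ext x y
  rw [localOp, diagonal_apply]
  by_cases hxy : x = y
  · subst hxy
    simp [sgn]
  · rw [if_neg hxy]
    split_ifs with h
    · have hne : x a ≠ y a := fun h' => hxy (funext fun j => by
        by_cases hj : j = a
        · rw [hj, h']
        · exact h j hj)
      generalize x a = s at hne
      generalize y a = t at hne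
      fin_cases s <;> fin_cases t <;> simp_all [pauliZ]
    · rfl

theorem zzGate_eq_diagonal (a b : Fin 8) (t : ℝ) :
    zzGate a b t = diagonal fun x => Complex.exp (Complex.I * t * (sgn (x a) * sgn (x b))) := by
  rw [zzGate, localOp_pauliZ, localOp_pauliZ, diagonal_mul_diagonal, ← diagonal_smul,
    exp_diagonal]
  congr 1
  ext x
  rw [Pi.coe_exp, Complex.exp_eq_exp_ℂ]
  rfl

/-- All gates are diagonal, so their order is immaterial and each contributes a phase. -/
theorem Circuit.output_apply (C : Circuit) (α : Fin 7 → ℝ) (x : Qubits) :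
    C.output α x = (∏ i, Complex.exp (Complex.I * α i * (sgn (x (C.fst i)) * sgn (x (C.snd i))))) *
      plus x := by
  have h : (List.ofFn fun i => zzGate (C.fst i) (C.snd i) (α i)).reverse.prod =
      diagonal fun x : Qubits =>
        ∏ i, Complex.exp (Complex.I * α i * (sgn (x (C.fst i)) * sgn (x (C.snd i)))) := by
    have h1 : (List.ofFn fun i => zzGate (C.fst i) (C.snd i) (α i)) =
        (List.ofFn fun i => fun x : Qubits =>
          Complex.exp (Complex.I * α i * (sgn (x (C.fst i)) * sgn (x (C.snd i))))).map
            (diagonalRingHom Qubits ℂ) := by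
      rw [List.map_ofFn]
      congr 1
      ext1 i
      exact zzGate_eq_diagonal _ _ _
    rw [h1, ← List.map_reverse, ← map_list_prod, List.prod_reverse, List.prod_ofFn]
    refine congrArg diagonal ?_
    exact funext fun x => Finset.prod_apply x _ _
  rw [Circuit.output, h, mulVec_diagonal]

/-- The two-qubit gate `exp(i π/4 Z ⊗ Z)` as a matrix from one qubit to the other. -/
def bellMatrix : Matrix (Fin 2) (Fin 2) ℂ :=
  of fun s t => Complex.exp (Complex.I * (Real.pi / 4 : ℝ) * (sgn s * sgn t))

/-- The determinant is `e^{iπ/2} - e^{-iπ/2} = 2i`. -/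
theorem det_bellMatrix_ne_zero : bellMatrix.det ≠ 0 := by
  have h1 : Complex.exp (Complex.I * (Real.pi / 4 : ℝ)) ^ 2 = Complex.I := by
    rw [← Complex.exp_nat_mul]
    refine Eq.trans (congrArg Complex.exp ?_) Complex.exp_pi_div_two_mul_I
    push_cast
    ring
  have h2 : Complex.exp (-(Complex.I * (Real.pi / 4 : ℝ))) ^ 2 = -Complex.I := by
    rw [Complex.exp_neg, inv_pow, h1, Complex.inv_I]
  have : bellMatrix.det = 2 * Complex.I := by
    rw [det_fin_two]
    simp only [bellMatrix, of_apply, sgn, pauliZ, cons_val_zero, cons_val_one, cons_val',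
      cons_val_fin_one, mul_one, mul_neg, neg_neg]
    rw [← pow_two, ← pow_two, h1, h2]
    ring
  rw [this]
  simp

theorem two_le_d₀ (k : Fin 8) : 2 ≤ d₀ k := by
  fin_cases k <;> simp [d₀]

theorem embed_castLE (ψ : Qubits → ℂ) (q : Qubits) :
    embed (d := d₀) ψ (fun k => Fin.castLE (two_le_d₀ k) (q k)) = ψ q :=
  dif_pos fun k => (q k).2

/-- A square matrix of amplitudes of full rank bounds the rank across the cut from below. -/
theorem card_le_cutRank_embed {m : Type*} [Fintype m] [DecidableEq m] (p : Fin 8 → Prop)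
    [DecidablePred p] (ψ : Qubits → ℂ) (q q' : m → Qubits) (A : Matrix m m ℂ)
    (hA : A.det ≠ 0) (h : ∀ i j, ψ (fun k => if p k then q i k else q' j k) = A i j) :
    Fintype.card m ≤ cutRank p (embed (d := d₀) ψ) := by
  have hsub : A = (cutMatrix p (embed (d := d₀) ψ)).submatrix
      (fun i k => Fin.castLE (two_le_d₀ k) (q i k))
      (fun j k => Fin.castLE (two_le_d₀ k) (q' j k)) := by
    ext i j
    refine (h i j).symm.trans ((embed_castLE ψ _).symm.trans (congrArg (embed ψ) ?_))
    funext k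
    by_cases hk : p k
    · rw [piEquivPiSubtypeProd_symm_pos p _ _ hk, if_pos hk]
    · rw [piEquivPiSubtypeProd_symm_neg p _ _ hk, if_neg hk]
  rw [← rank_of_isUnit A ((isUnit_iff_isUnit_det A).2 hA.isUnit), cutRank, hsub]
  exact rank_submatrix_le _ _ _

theorem plus_ne_zero (x : Qubits) : plus x ≠ 0 := by
  simp [plus]

namespace Circuit

variable (C : Circuit) (p : Fin 8 → Prop) [DecidablePred p]

/-- The gate `i` joins `a` and `b`. -/
def Joins (i : Fin 7) (a b : Fin 8) : Prop :=
  (C.fst i = a ∧ C.snd i = b) ∨ (C.fst i = b ∧ C.snd i = a)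

theorem Joins.sgn_mul {C : Circuit} {i : Fin 7} {a b : Fin 8} (h : C.Joins i a b) (x : Qubits) :
    sgn (x (C.fst i)) * sgn (x (C.snd i)) = sgn (x a) * sgn (x b) := by
  rcases h with ⟨rfl, rfl⟩ | ⟨rfl, rfl⟩
  · rfl
  · exact mul_comm _ _

/-- The angle `π/4` at the gates in `s`, and `0` at the others. -/
def quarterAngle (s : Finset (Fin 7)) (i : Fin 7) : ℝ := if i ∈ s then Real.pi / 4 else 0

theorem embed_output_mem_targetSet (s : Finset (Fin 7)) :
    embed (C.output (quarterAngle s)) ∈ targetSet C := by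
  refine ⟨_, ⟨_, fun i => ?_, rfl⟩, rfl⟩
  have := Real.pi_pos
  unfold quarterAngle
  split_ifs <;> constructor <;> linarith

theorem output_quarterAngle (s : Finset (Fin 7)) (x : Qubits) :
    C.output (quarterAngle s) x =
      (∏ i ∈ s, Complex.exp (Complex.I * (Real.pi / 4 : ℝ) *
        (sgn (x (C.fst i)) * sgn (x (C.snd i))))) * plus x := by
  rw [output_apply]
  congr 1
  rw [← Finset.prod_subset (Finset.subset_univ s)]
  · refine Finset.prod_congr rfl fun i hi => ?_
    rw [quarterAngle, if_pos hi]
  · intro i _ hi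
    rw [quarterAngle, if_neg hi]
    simp

theorem Joins.output_quarterAngle_singleton {C : Circuit} {i : Fin 7} {a b : Fin 8}
    (hi : C.Joins i a b) (x : Qubits) :
    C.output (quarterAngle {i}) x = bellMatrix (x a) (x b) * plus 0 := by
  rw [output_quarterAngle, Finset.prod_singleton, hi.sgn_mul]
  rfl

theorem Joins.output_quarterAngle_pair {C : Circuit} {i j : Fin 7} {a b c e : Fin 8}
    (hi : C.Joins i a b) (hj : C.Joins j c e) (hij : i ≠ j) (x : Qubits) :
    C.output (quarterAngle {i, j}) x =
      bellMatrix (x a) (x b) * bellMatrix (x c) (x e) * plus 0 := by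
  rw [output_quarterAngle, Finset.prod_pair hij, hi.sgn_mul, hj.sgn_mul]
  rfl

theorem exists_two_le_cutRank {a b : Fin 8} (hab : C.interaction.Adj a b) (ha : p a)
    (hb : ¬ p b) : ∃ ψ ∈ targetSet C, 2 ≤ cutRank p ψ := by
  obtain ⟨i, hi⟩ : ∃ i, C.Joins i a b := hab
  refine ⟨_, C.embed_output_mem_targetSet {i}, ?_⟩
  have hc := plus_ne_zero 0
  -- Only the bits at `a` and `b` matter, so each side may carry one common bit.
  have := card_le_cutRank_embed p (C.output (quarterAngle {i})) (fun s _ => s) (fun t _ => t)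
    (plus 0 • bellMatrix) (by
      rw [det_smul]
      exact mul_ne_zero (pow_ne_zero _ hc) det_bellMatrix_ne_zero) fun s t => by
    rw [hi.output_quarterAngle_singleton, if_pos ha, if_neg hb]
    exact mul_comm _ _
  simpa using this

theorem exists_four_le_cutRank {a b c e : Fin 8} (hab : C.interaction.Adj a b)
    (hce : C.interaction.Adj c e) (ha : p a) (hb : ¬ p b) (hc : p c) (he : ¬ p e)
    (hac : a ≠ c) (hbe : b ≠ e) : ∃ ψ ∈ targetSet C, 4 ≤ cutRank p ψ := by
  obtain ⟨i, hi⟩ : ∃ i, C.Joins i a b := hab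
  obtain ⟨j, hj⟩ : ∃ i, C.Joins i c e := hce
  -- One gate cannot serve both edges: with equal orientation their ends would coincide, with
  -- opposite orientation an end would lie on both sides.
  have hij : i ≠ j := by
    rintro rfl
    rcases hi with ⟨h1, h2⟩ | ⟨h1, h2⟩ <;> rcases hj with ⟨h3, h4⟩ | ⟨h3, h4⟩
    · exact hac (h1.symm.trans h3)
    · exact he (h3 ▸ h1 ▸ ha)
    · exact hb (h1 ▸ h3 ▸ hc)
    · exact hbe (h1.symm.trans h3)
  refine ⟨_, C.embed_output_mem_targetSet {i, j}, ?_⟩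
  have h0 := plus_ne_zero 0
  have := card_le_cutRank_embed p (C.output (quarterAngle {i, j}))
    -- The two bits of a row sit at `a` and `c`, those of a column at `b` and `e`. The gates are
    -- disjoint, so the amplitudes form a Kronecker product, of rank 4.
    (fun (s : Fin 2 × Fin 2) k => if k = a then s.1 else s.2)
    (fun (t : Fin 2 × Fin 2) k => if k = b then t.1 else t.2)
    (plus 0 • kroneckerMap (· * ·) bellMatrix bellMatrix) (by
      rw [det_smul, det_kronecker]
      exact mul_ne_zero (pow_ne_zero _ h0) (mul_ne_zero (pow_ne_zero _ det_bellMatrix_ne_zero)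
        (pow_ne_zero _ det_bellMatrix_ne_zero))) fun s t => by
    rw [hi.output_quarterAngle_pair hj hij]
    simp only [ha, hb, hc, he, hac.symm, hbe.symm, if_true, if_false]
    exact mul_comm _ _
  simpa using this

end Circuit

/-! ## Linear layouts of trees -/

/-- All of `a`, `b` lie on one side of all of `c`, `e`. -/
def Separated (a b c e : ℕ) : Prop :=
  (a < c ∧ a < e ∧ b < c ∧ b < e) ∨ (c < a ∧ c < b ∧ e < a ∧ e < b)

/-- In a linear layout of the spider with centre `w` and three legs `w - xᵢ - yᵢ`, some cut
separates the ends of two disjoint edges. -/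
theorem not_forall_separated_spider {w : ℕ} {x y : Fin 3 → ℕ}
    (h₁ : ∀ i j, i ≠ j → Separated (x i) (y i) (x j) (y j))
    (h₂ : ∀ i j, i ≠ j → Separated w (x i) (x j) (y j)) : False := by
  have a1 := h₁ 0 1 (by decide)
  have a2 := h₁ 0 2 (by decide)
  have a3 := h₁ 1 2 (by decide)
  have b1 := h₂ 0 1 (by decide)
  have b2 := h₂ 0 2 (by decide)
  have b3 := h₂ 1 0 (by decide)
  have b4 := h₂ 1 2 (by decide)
  have b5 := h₂ 2 0 (by decide)
  have b6 := h₂ 2 1 (by decide)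
  unfold Separated at *
  omega

section Graph

variable {V : Type*} {G : SimpleGraph V}

/-- A triangle would contain two paths from `a` to `c`. -/
theorem _root_.SimpleGraph.IsAcyclic.not_adj_of_adj_adj (hG : G.IsAcyclic) {a b c : V}
    (hab : G.Adj a b) (hbc : G.Adj b c) : ¬ G.Adj a c := by
  intro hac
  have := hG.subsingleton_path a c
  have h := Subsingleton.elim
    (⟨.cons hab (.cons hbc .nil), by simp [hab.ne, hbc.ne, hac.ne]⟩ : G.Path a c)
    ⟨.cons hac .nil, by simp [hac.ne]⟩
  have := congrArg (fun q : G.Path a c => q.1.length) h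
  simp at this

theorem _root_.SimpleGraph.IsAcyclic.eq_of_adj_adj (hG : G.IsAcyclic) {a b b' c : V}
    (hac : a ≠ c) (hab : G.Adj a b) (hbc : G.Adj b c) (hab' : G.Adj a b') (hbc' : G.Adj b' c) :
    b = b' := by
  have := hG.subsingleton_path a c
  have h := Subsingleton.elim
    (⟨.cons hab (.cons hbc .nil), by simp [hab.ne, hbc.ne, hac]⟩ : G.Path a c)
    ⟨.cons hab' (.cons hbc' .nil), by simp [hab'.ne, hbc'.ne, hac]⟩
  have := congrArg (fun q : G.Path a c => q.1.support) h
  simpa using this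

theorem exists_adj_dist_eq (hG : G.Connected) {v₀ a : V} {n : ℕ} (h : G.dist v₀ a = n + 1) :
    ∃ b, G.Adj a b ∧ G.dist v₀ b = n := by
  obtain ⟨q, hq⟩ := hG.exists_walk_length_eq_dist a v₀
  rw [SimpleGraph.dist_comm, h] at hq
  cases q with
  | nil => simp at hq
  | @cons _ b _ hab q =>
    refine ⟨b, hab, ?_⟩
    have h1 : G.dist v₀ b ≤ n := by
      rw [SimpleGraph.dist_comm]
      exact (SimpleGraph.dist_le q).trans (by simpa using hq.le)
    have h2 : G.dist v₀ a ≤ G.dist v₀ b + G.dist b a := hG.dist_triangle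
    have h3 : G.dist b a = 1 := SimpleGraph.dist_eq_one_iff_adj.2 hab.symm
    omega

/-- A connected graph with degrees at most two is a path if some vertex has degree at most one. -/
theorem dist_injective_of_degree_le (hG : G.Connected) (v₀ : V)
    (h₁ : ∀ a b, G.Adj v₀ a → G.Adj v₀ b → a = b)
    (h₂ : ∀ k a b c, G.Adj k a → G.Adj k b → G.Adj k c → a = b ∨ a = c ∨ b = c) :
    Function.Injective (G.dist v₀) := by
  suffices h : ∀ n a b, G.dist v₀ a = n → G.dist v₀ b = n → a = b from
    fun a b hab => h _ a b rfl hab.symm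
  intro n
  induction n with
  | zero =>
    intro a b ha hb
    rw [← hG.dist_eq_zero_iff.1 ha, ← hG.dist_eq_zero_iff.1 hb]
  | succ n ih =>
    intro a b ha hb
    obtain ⟨a', haa', ha'⟩ := exists_adj_dist_eq hG ha
    obtain ⟨b', hbb', hb'⟩ := exists_adj_dist_eq hG hb
    obtain rfl := ih a' b' ha' hb'
    -- `a` and `b` now share the predecessor `a'`. Either it is `v₀`, of degree at most one, or it
    -- already uses one of its two edges towards `v₀`.
    cases n with
    | zero =>
      obtain rfl := hG.dist_eq_zero_iff.1 ha'
      exact h₁ _ _ haa'.symm hbb'.symm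
    | succ m =>
      obtain ⟨c, hac, hc⟩ := exists_adj_dist_eq hG ha'
      rcases h₂ _ _ _ _ haa'.symm hbb'.symm hac with h | h | h
      · exact h
      · subst h; omega
      · subst h; omega

theorem dist_eq_add_one_of_adj (hG : G.Connected) {v₀ a b : V} {t : ℕ} (hab : G.Adj a b)
    (ha : G.dist v₀ a ≤ t) (hb : t < G.dist v₀ b) : G.dist v₀ a = t ∧ G.dist v₀ b = t + 1 := by
  have h2 : G.dist v₀ b ≤ G.dist v₀ a + G.dist a b := hG.dist_triangle
  have h3 : G.dist a b = 1 := SimpleGraph.dist_eq_one_iff_adj.2 hab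
  omega

/-- If no cut of a linear layout separates the ends of two disjoint edges, then disjoint edges
occupy disjoint intervals. -/
theorem separated_of_layout {pos : V → ℕ} (hinj : Function.Injective pos)
    (hcut : ∀ a b c e t, G.Adj a b → G.Adj c e → pos a ≤ t → t < pos b → pos c ≤ t → t < pos e →
      a = c ∨ b = e) {a b c e : V} (hab : G.Adj a b) (hce : G.Adj c e) (hac : a ≠ c) (hae : a ≠ e)
    (hbc : b ≠ c) (hbe : b ≠ e) : Separated (pos a) (pos b) (pos c) (pos e) := by
  have key : ∀ {a b c e : V}, G.Adj a b → G.Adj c e → a ≠ c → a ≠ e → b ≠ c → b ≠ e →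
      pos a < pos b → pos c < pos e → pos b < pos c ∨ pos e < pos a := by
    intro a b c e hab hce hac hae hbc hbe h1 h2
    by_contra! h
    have h3 := hinj.ne hae
    have h4 := hinj.ne hbc
    -- Overlapping intervals are both cut just after the later of their left ends.
    rcases hcut a b c e (max (pos a) (pos c)) hab hce (le_max_left _ _) (by omega)
      (le_max_right _ _) (by omega) with h | h
    · exact hac h
    · exact hbe h
  have h1 := hinj.ne hab.ne
  have h2 := hinj.ne hce.ne
  unfold Separated
  rcases lt_or_gt_of_ne h1 with h1 | h1 <;> rcases lt_or_gt_of_ne h2 with h2 | h2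
  · have := key hab hce hac hae hbc hbe h1 h2; omega
  · have := key hab hce.symm hae hac hbe hbc h1 h2; omega
  · have := key hab.symm hce hbc hbe hac hae h1 h2; omega
  · have := key hab.symm hce.symm hbe hbc hae hac h1 h2; omega

end Graph

/-! ### Layouts of the interaction tree -/

namespace Circuit

variable (C : Circuit)

/-- Seven gates give at most seven edges, and connecting eight vertices needs seven. -/
theorem isAcyclic_interaction (hC : C.interaction.Connected) : C.interaction.IsAcyclic := by
  refine (SimpleGraph.isTree_iff_connected_and_card.2 ⟨hC, le_antisymm ?_
    hC.card_vert_le_card_edgeSet_add_one⟩).isAcyclic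
  have hsub : C.interaction.edgeSet ⊆ Set.range fun i => s(C.fst i, C.snd i) := by
    intro e
    induction e with
    | _ x y =>
      rintro ⟨i, ⟨rfl, rfl⟩ | ⟨rfl, rfl⟩⟩
      · exact ⟨i, rfl⟩
      · exact ⟨i, Sym2.eq_swap⟩
  have h1 : C.interaction.edgeSet.ncard ≤ 7 := by
    refine (Set.ncard_le_ncard hsub (Set.finite_range _)).trans ?_
    rw [← Set.image_univ]
    refine (Set.ncard_image_le Set.finite_univ).trans ?_
    simp [Set.ncard_univ]
  rw [Nat.card_coe_set_eq]
  simp only [Nat.card_eq_fintype_card, Fintype.card_fin]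
  omega

/-- A branching vertex is the centre of a spider in the extended tree. Acyclicity makes its legs
disjoint, and the hung path lies to the left of all parties, so the layout would separate the
spider's disjoint edges. -/
theorem not_branching_of_layout (hC : C.interaction.IsAcyclic) {pos : Fin 8 → ℕ}
    (hinj : Function.Injective pos) (h7 : pos 7 = 0)
    (hcut : ∀ a b c e t, C.interaction.Adj a b → C.interaction.Adj c e → pos a ≤ t →
      t < pos b → pos c ≤ t → t < pos e → a = c ∨ b = e) : ¬ C.Branching := by
  rintro ⟨w, hw⟩
  -- The positions `1` and `0` are those of the path hung on the last party.
  set P : Fin 8 → ℕ := fun v => pos v + 2 with hP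
  have hpos : ∀ v, v ≠ 7 → 2 < P v := fun v hv => by
    have := hinj.ne hv
    simp only [hP]
    omega
  have hP7 : P 7 = 2 := by simp [hP, h7]
  have hsep : ∀ {a b c e}, C.interaction.Adj a b → C.interaction.Adj c e → a ≠ c → a ≠ e →
      b ≠ c → b ≠ e → Separated (P a) (P b) (P c) (P e) := by
    intro a b c e hab hce hac hae hbc hbe
    have := separated_of_layout hinj hcut hab hce hac hae hbc hbe
    simp only [Separated, hP] at this ⊢
    omega
  -- `y` is the position of the outer vertex of the leg through `x`: a party, or the first vertex of
  -- the hung path.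
  have harm : ∀ x, C.LongArm w x → ∃ y : ℕ, (x = 7 ∧ y = 1) ∨
      ∃ z, z ≠ w ∧ C.interaction.Adj x z ∧ y = P z := by
    rintro x ⟨-, h | ⟨z, hz, hxz⟩⟩
    · exact ⟨1, .inl ⟨h, rfl⟩⟩
    · exact ⟨P z, .inr ⟨z, hz, hxz, rfl⟩⟩
  choose! Y hY using harm
  have hpair : ∀ x x', C.LongArm w x → C.LongArm w x' → x ≠ x' →
      Separated (P x) (Y x) (P x') (Y x') := by
    intro x x' hx hx' hne
    rcases hY x hx with ⟨rfl, h1⟩ | ⟨z, hz, hxz, h1⟩ <;>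
      rcases hY x' hx' with ⟨rfl, h2⟩ | ⟨z', hz', hxz', h2⟩
    · exact absurd rfl hne
    · have h3 : z' ≠ 7 := by
        rintro rfl
        exact hC.not_adj_of_adj_adj hx'.1 hxz' hx.1
      have := hpos _ hne.symm
      have := hpos _ h3
      unfold Separated
      omega
    · have h3 : z ≠ 7 := by
        rintro rfl
        exact hC.not_adj_of_adj_adj hx.1 hxz hx'.1
      have := hpos _ hne
      have := hpos _ h3
      unfold Separated
      omega
    · rw [h1, h2]
      refine hsep hxz hxz' hne ?_ ?_ ?_
      · rintro rfl
        exact hC.not_adj_of_adj_adj hx'.1 hxz' hx.1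
      · rintro rfl
        exact hC.not_adj_of_adj_adj hx.1 hxz hx'.1
      · rintro rfl
        exact hne (hC.eq_of_adj_adj hz.symm hx.1 hxz hx'.1 hxz')
  have hcentre : ∀ x x', C.LongArm w x → C.LongArm w x' → x ≠ x' → w ≠ 7 →
      Separated (P w) (P x) (P x') (Y x') := by
    intro x x' hx hx' hne hw7
    rcases hY x' hx' with ⟨rfl, h2⟩ | ⟨z', hz', hxz', h2⟩
    · have := hpos _ hne
      have := hpos _ hw7
      unfold Separated
      omega
    · rw [h2]
      refine hsep hx.1 hxz' hx'.1.ne hz'.symm hne ?_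
      rintro rfl
      exact hC.not_adj_of_adj_adj hx'.1 hxz' hx.1
  -- At the last party the hung path is the third leg. Both other legs lie to the right of the
  -- centre, so the edge from the centre to the farther leg spans the nearer one.
  by_cases hw7 : w = 7
  · subst hw7
    have h2 : 1 < {x | C.LongArm 7 x}.ncard := by
      rw [if_pos rfl] at hw
      omega
    obtain ⟨x₁, x₂, hx₁, hx₂, hne⟩ := (Set.one_lt_ncard_iff (Set.toFinite _)).1 h2
    have hY' : ∀ x, C.LongArm 7 x → 2 < P x ∧ 2 < Y x ∧ ∀ x', C.LongArm 7 x' → x' ≠ x →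
        Separated (P 7) (P x') (P x) (Y x) := by
      intro x hx
      rcases hY x hx with ⟨rfl, -⟩ | ⟨z, hz, hxz, h1⟩
      · exact absurd hx.1 (C.interaction.loopless.irrefl 7)
      · refine ⟨hpos _ hx.1.ne', h1 ▸ hpos _ hz, fun x' hx' hne => ?_⟩
        rw [h1]
        refine hsep hx'.1 hxz hx.1.ne hz.symm hne ?_
        rintro rfl
        exact hC.not_adj_of_adj_adj hx.1 hxz hx'.1
    have a := hpair x₁ x₂ hx₁ hx₂ hne
    obtain ⟨b1, b2, b3⟩ := hY' x₁ hx₁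
    obtain ⟨c1, c2, c3⟩ := hY' x₂ hx₂
    have b4 := b3 x₂ hx₂ hne.symm
    have c4 := c3 x₁ hx₁ hne
    unfold Separated at *
    omega
  · have h2 : 2 < {x | C.LongArm w x}.ncard := by
      rw [if_neg hw7] at hw
      omega
    obtain ⟨x₁, x₂, x₃, hx₁, hx₂, hx₃, h12, h13, h23⟩ :=
      (Set.two_lt_ncard_iff (Set.toFinite _)).1 h2
    have hx : ∀ i, C.LongArm w (![x₁, x₂, x₃] i) := by
      intro i
      fin_cases i
      exacts [hx₁, hx₂, hx₃]
    have hne : ∀ i j : Fin 3, i ≠ j → ![x₁, x₂, x₃] i ≠ ![x₁, x₂, x₃] j := by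
      intro i j hij
      fin_cases i <;> fin_cases j <;> simp_all [Ne.symm]
    exact not_forall_separated_spider (w := P w) (x := fun i => P (![x₁, x₂, x₃] i))
      (y := fun i => Y (![x₁, x₂, x₃] i))
      (fun i j hij => hpair _ _ (hx i) (hx j) (hne i j hij))
      (fun i j hij => hcentre _ _ (hx i) (hx j) (hne i j hij) hw7)

theorem connected_layeredCircuit : layeredCircuit.interaction.Connected := by
  have hadj : ∀ i, layeredCircuit.interaction.Adj (layeredCircuit.fst i) (layeredCircuit.snd i) :=
    fun i => ⟨i, .inl ⟨rfl, rfl⟩⟩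
  have h3 : layeredCircuit.interaction.Reachable 3 7 := (hadj 6).reachable
  have h5 : layeredCircuit.interaction.Reachable 5 7 := (hadj 5).reachable
  have h1 : layeredCircuit.interaction.Reachable 1 7 := (hadj 4).reachable.trans h3
  have h : ∀ v, layeredCircuit.interaction.Reachable v 7 := by
    intro v
    fin_cases v
    exacts [(hadj 0).reachable.trans h1, h1, (hadj 1).reachable.trans h3, h3,
      (hadj 2).reachable.trans h5, h5, (hadj 3).reachable, .rfl]
  exact ⟨fun u v => (h u).trans (h v).symm⟩

theorem branching_layeredCircuit : layeredCircuit.Branching := by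
  refine ⟨7, ?_⟩
  -- The arms `v₈v₄v₂` and `v₈v₆v₅`; the hung path is the third.
  have h : ({3, 5} : Set (Fin 8)) ⊆ {x | layeredCircuit.LongArm 7 x} := by
    rintro x (rfl | rfl)
    · exact ⟨⟨6, .inr ⟨rfl, rfl⟩⟩, .inr ⟨1, by decide, ⟨4, .inr ⟨rfl, rfl⟩⟩⟩⟩
    · exact ⟨⟨5, .inr ⟨rfl, rfl⟩⟩, .inr ⟨4, by decide, ⟨2, .inr ⟨rfl, rfl⟩⟩⟩⟩
  have := Set.ncard_le_ncard h (Set.toFinite _)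
  rw [Set.ncard_pair (by decide)] at this
  rw [if_pos rfl]
  omega

theorem exists_adj_of_connected (hC : C.interaction.Connected) (p : Fin 8 → Prop) {u v : Fin 8}
    (hu : p u) (hv : ¬ p v) : ∃ a b, C.interaction.Adj a b ∧ p a ∧ ¬ p b := by
  obtain ⟨q⟩ := hC.preconnected u v
  obtain ⟨e, -, h1, h2⟩ := q.exists_boundary_dart {x | p x} hu hv
  exact ⟨_, _, e.adj, h1, h2⟩

end Circuit

/-! ### The resource graph is a path with cuts of rank at most two -/

open Classical in
theorem not_achievableByBipartite_targetSet (C : Circuit) (hC : C.interaction.Connected)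
    (hB : C.Branching) : ¬ AchievableByBipartite d₀ (targetSet C) := by
  rintro ⟨φ, -, ⟨D, W, hW, hφ⟩, hres⟩
  have hle : ∀ (p : Fin 8 → Prop) [DecidablePred p], ∀ ψ ∈ targetSet C,
      cutRank p ψ ≤ cutRank p D.amplitude := by
    intro p _ ψ hψ
    refine ((hres ψ hψ).cutRank_le p).trans ?_
    have : φ = tensorApply W D.amplitude := funext hφ
    rw [this]
    exact cutRank_tensorApply_le p W _
  have hdim : ∀ (k : Fin 8) (s : Finset (Fin 8)), (∀ l ∈ s, D.graph.Adj k l) →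
      ∏ l ∈ s, D.dim k l ≤ d₀ k := fun k s hs =>
    (D.prod_dim_le_card_local s hs).trans (D.card_local_le (W k) (hW k))
  have hd : ∀ k, d₀ k ≤ 4 := by
    intro k
    fin_cases k <;> simp [d₀]
  have hpairs : ∀ k a b, D.graph.Adj k a → D.graph.Adj k b → a ≠ b →
      D.dim k a * D.dim k b ≤ d₀ k := by
    intro k a b ha hb hab
    have := hdim k {a, b} (by simp [ha, hb])
    rwa [Finset.prod_pair hab] at this
  have hdeg7 : ∀ a b, D.graph.Adj 7 a → D.graph.Adj 7 b → a = b := by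
    intro a b ha hb
    by_contra hab
    have h1 : D.dim 7 a * D.dim 7 b ≤ 2 := hpairs 7 a b ha hb hab
    have h2 := Nat.mul_le_mul (D.two_le_dim ha) (D.two_le_dim hb)
    omega
  have hdeg : ∀ k a b c, D.graph.Adj k a → D.graph.Adj k b → D.graph.Adj k c →
      a = b ∨ a = c ∨ b = c := by
    intro k a b c ha hb hc
    by_contra! h
    have h1 := (hdim k {a, b, c} (by simp [ha, hb, hc])).trans (hd k)
    rw [Finset.prod_insert (by simp [h.1, h.2.1]), Finset.prod_pair h.2.2] at h1
    have h2 := Nat.mul_le_mul (D.two_le_dim ha)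
      (Nat.mul_le_mul (D.two_le_dim hb) (D.two_le_dim hc))
    omega
  -- Otherwise the component of the last party is a cut of resource rank at most 1, while a gate
  -- crossing it gives a target of rank 2.
  have hconn : D.graph.Connected := by
    have hreach : ∀ v, D.graph.Reachable 7 v := by
      by_contra! hv
      obtain ⟨v, hv⟩ := hv
      obtain ⟨a, b, hab, ha, hb⟩ := C.exists_adj_of_connected hC (D.graph.Reachable 7 ·) .rfl hv
      obtain ⟨ψ, hψ, h2⟩ := C.exists_two_le_cutRank (D.graph.Reachable 7 ·) hab ha hb
      have h1 := D.cutRank_amplitude_le_one (D.graph.Reachable 7 ·) fun a b hab =>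
        ⟨fun h => h.trans hab.reachable, fun h => h.trans hab.symm.reachable⟩
      exact absurd (h2.trans ((hle (D.graph.Reachable 7 ·) ψ hψ).trans h1)) (by decide)
    exact ⟨fun u v => (hreach u).symm.trans (hreach v)⟩
  have hinj := dist_injective_of_degree_le hconn 7 hdeg7 hdeg
  refine C.not_branching_of_layout (C.isAcyclic_interaction hC) hinj SimpleGraph.dist_self ?_ hB
  intro a b c e t hab hce ha hb hc he
  by_contra! hne
  obtain ⟨ψ, hψ, h4⟩ := C.exists_four_le_cutRank (fun v => D.graph.dist 7 v ≤ t) hab hce ha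
    (not_le.2 hb) hc (not_le.2 he) hne.1 hne.2
  -- Some resource edge leaves the ball of radius `t`, and it is the only one because distances from
  -- the last party are distinct.
  obtain ⟨q⟩ := hconn.preconnected a b
  obtain ⟨g, -, h1, h2⟩ := q.exists_boundary_dart {v | D.graph.dist 7 v ≤ t} ha (not_le.2 hb)
  obtain ⟨h5, h6⟩ := dist_eq_add_one_of_adj hconn g.adj h1 (not_le.1 h2)
  have h7 := D.cutRank_amplitude_le_dim (fun v => D.graph.dist 7 v ≤ t) g.adj h1 h2
    fun x y hxy hx hy => by
      obtain ⟨h8, h9⟩ := dist_eq_add_one_of_adj hconn hxy hx (not_le.1 hy)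
      exact ⟨hinj (h8.trans h5.symm), hinj (h9.trans h6.symm)⟩
  -- For `t = 0` the near end is the last party. Otherwise it has a further edge, towards the last
  -- party, which takes a factor of 2 out of 4.
  have h8 : D.dim g.fst g.snd ≤ 2 := by
    cases t with
    | zero =>
      have h9 : 7 = g.fst := hconn.dist_eq_zero_iff.1 h5
      have := hdim g.fst {g.snd} (by simp [g.adj])
      rw [Finset.prod_singleton] at this
      have h10 : d₀ g.fst = 2 := by rw [← h9]; rfl
      omega
    | succ m =>
      obtain ⟨z, hz, hzd⟩ := exists_adj_dist_eq hconn h5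
      have h9 := (hpairs g.fst g.snd z g.adj hz (by rintro rfl; omega)).trans (hd _)
      have h10 := D.two_le_dim hz
      have := Nat.mul_le_mul_left (D.dim g.fst g.snd) h10
      omega
  exact absurd (h4.trans ((hle (fun v => D.graph.dist 7 v ≤ t) ψ hψ).trans (h7.trans h8)))
    (by decide)

end BipartiteResource

end

theorem proposition2 :
    ¬ BipartiteResource.AchievableByBipartite BipartiteResource.d₀
        (BipartiteResource.targetSet BipartiteResource.layeredCircuit) ∧
    ∀ C : BipartiteResource.Circuit, C.interaction.Connected → C.Branching →
      ¬ BipartiteResource.AchievableByBipartite BipartiteResource.d₀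
        (BipartiteResource.targetSet C) :=
  ⟨BipartiteResource.not_achievableByBipartite_targetSet _
      BipartiteResource.Circuit.connected_layeredCircuit
      BipartiteResource.Circuit.branching_layeredCircuit,
    BipartiteResource.not_achievableByBipartite_targetSet⟩
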